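/- All rings are commutative. Let $(A,\mathfrak m,k)$ be a noetherian local ring. An $A$-module $M$ of finite type is called a \emph{test module} for $A$ if, for every local homomorphism of noetherian local rings $A\to B$ and every $B$-module $N$ of finite type such that $\operatorname{Tor}_i^A(M,N)=0$ for all $i\gg 0$, the flat dimension $\operatorname{fd}_A(N)$ of $N$ over $A$ is finite. A local homomorphism of noetherian local rings $(A,\mathfrak m,k)\to(A',\mathfrak m',k')$ is called \emph{weakly regular} if it is flat and its closed fibre $A'\otimes_A k$ is a regular local ring. Let $(A,\mathfrak m,k)\to(A',\mathfrak m',k')$ be a weakly regular homomorphism of noetherian local rings. If $M$ is a test module for $A$, then $A'\otimes_A M$ is a test module for $A'$. -/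

import Mathlib

open CategoryTheory TensorProduct

universe u

/-- `HasFlatDimensionLE A n N`: the `A`-module `N` has flat dimension at most `n`, i.e. there is an
exact sequence `0 → Fₙ → ⋯ → F₁ → F₀ → N → 0` with all `Fᵢ` flat over `A`. The sequence is encoded
one step at a time: `F₀ → N` is surjective with `F₀` flat, and its kernel has a flat resolution
of length at most `n - 1`. -/
def HasFlatDimensionLE (A : Type u) [CommRing A] :
    ℕ → (N : Type u) → [AddCommGroup N] → [Module A N] → Prop
  | 0, N, _, _ => Module.Flat A N
  | n + 1, N, _, _ =>
      ∃ (F : Type u) (_ : AddCommGroup F) (_ : Module A F) (f : F →ₗ[A] N),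
        Module.Flat A F ∧ Function.Surjective f ∧ HasFlatDimensionLE A n (LinearMap.ker f)

/-- The flat dimension of `N` over `A` is finite. -/
def HasFiniteFlatDimension (A : Type u) [CommRing A] (N : Type u) [AddCommGroup N] [Module A N] :
    Prop :=
  ∃ n : ℕ, HasFlatDimensionLE A n N

/-- `Tor_i^A(M, N) = 0` for all sufficiently large `i`. Here `Tor_i^A(M, N)` is the homology of
`P ⊗ N` for a projective resolution `P` of `M`. -/
def TorEventuallyZero (A : Type u) [CommRing A] (M N : Type u) [AddCommGroup M] [Module A M]
    [AddCommGroup N] [Module A N] : Prop :=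
  ∃ n : ℕ, ∀ i : ℕ, n ≤ i →
    Limits.IsZero (((Tor' (ModuleCat.{u} A) i).obj (ModuleCat.of A M)).obj (ModuleCat.of A N))

/-- `M` is a test module for the noetherian local ring `A`: it is of finite type and, for every
local homomorphism `A → B` of noetherian local rings and every `B`-module `N` of finite type
(regarded as an `A`-module through `A → B`), if `Tor_i^A(M, N) = 0` for all `i ≫ 0`, then `N` has
finite flat dimension over `A`. -/
structure IsTestModule (A : Type u) [CommRing A] [IsLocalRing A] [IsNoetherianRing A]
    (M : Type u) [AddCommGroup M] [Module A M] : Prop where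
  finite : Module.Finite A M
  test : ∀ (B : Type u) [CommRing B] [IsLocalRing B] [IsNoetherianRing B] [Algebra A B]
    [IsLocalHom (algebraMap A B)]
    (N : Type u) [AddCommGroup N] [Module B N] [Module A N] [IsScalarTower A B N]
    [Module.Finite B N],
    TorEventuallyZero A M N → HasFiniteFlatDimension A N

/-- The homomorphism `A → A'` of noetherian local rings is weakly regular: it is local and flat, and
its closed fibre `A' ⊗ k`, where `k` is the residue field of `A`, is a regular local ring. -/
structure IsWeaklyRegular (A A' : Type u) [CommRing A] [IsLocalRing A] [IsNoetherianRing A]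
    [CommRing A'] [IsLocalRing A'] [IsNoetherianRing A'] [Algebra A A'] : Prop where
  isLocalHom : IsLocalHom (algebraMap A A')
  flat : Module.Flat A A'
  regular : IsRegularLocalRing (A' ⊗[A] IsLocalRing.ResidueField A)

/-! Let $N$ be finite over a local $A'$-algebra $B$ (noetherian, with $A'\to B$ local) with
$\operatorname{Tor}^{A'}_i(A'\otimes_A M,N)=0$ for $i\gg0$. Flat base change identifies this with
vanishing of $\operatorname{Tor}^A_i(M,N)$, so the test property gives $\operatorname{fd}_A
N<\infty$. What remains is to climb from $A$ to $A'$ (`IsWeaklyRegular.hasFiniteFlatDimension`).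

Base change again gives $\operatorname{Tor}^{A'}_i(R,N)=0$ for $i\gg0$, where $R=A'\otimes_A k$ is
regular and a quotient of $A'$. Dividing $R$ by regular parameters one at a time carries the
vanishing to the residue field of $A'$
(`TorSuccVanishes.quotient_maximalIdeal_of_isRegularLocalRing`). Vanishing there in a single degree
spreads to every $A'/I$ by noetherian induction and Nakayama over $B$
(`TorSuccVanishes.quotient_of_residueField`), which bounds the flat dimension.

Only vanishing of Tor is ever needed, so long exact sequences are replaced by dimension shifting
down to $\operatorname{Tor}_1$, where vanishing is injectivity of a tensored map. -/

/-! ### Left derived functors and syzygies. -/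

section
open Limits
universe v w
variable {C : Type w} [Category.{v} C] [Abelian C]

/-- The augmentation of a projective resolution, as a map to the resolved object. -/
noncomputable def CategoryTheory.ProjectiveResolution.augmentation {Z : C}
    (P : ProjectiveResolution Z) : P.complex.X 0 ⟶ Z :=
  P.π.f 0

instance {Z : C} (P : ProjectiveResolution Z) : Epi P.augmentation :=
  inferInstanceAs (Epi (P.π.f 0))

theorem CategoryTheory.ProjectiveResolution.d_comp_augmentation {Z : C}
    (P : ProjectiveResolution Z) : P.complex.d 1 0 ≫ P.augmentation = 0 :=
  P.complex_d_comp_π_f_zero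

theorem CategoryTheory.ProjectiveResolution.exact_augmentation {Z : C}
    (P : ProjectiveResolution Z) :
    (ShortComplex.mk (P.complex.d 1 0) P.augmentation P.d_comp_augmentation).Exact :=
  P.exact₀

/-- A projective resolution of `S.X₁` extends to one of `S.X₃` when `S` is short exact with
projective middle term. -/
noncomputable def CategoryTheory.ProjectiveResolution.ofShortExact {S : ShortComplex C}
    (hS : S.ShortExact) [Projective S.X₂] (Q : ProjectiveResolution S.X₁) :
    ProjectiveResolution S.X₃ where
  complex := Q.complex.augment (Q.augmentation ≫ S.f) (by
    rw [← Category.assoc, Q.d_comp_augmentation, zero_comp])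
  projective n := by
    cases n with
    | zero => exact ‹Projective S.X₂›
    | succ n => exact Q.projective n
  π := (ChainComplex.toSingle₀Equiv _ _).symm ⟨S.g, by
    have h : (Q.augmentation ≫ S.f) ≫ S.g = 0 := by rw [Category.assoc, S.zero, comp_zero]
    exact h⟩
  quasiIso := ⟨fun n => by
    have hf := hS.mono_f
    have hg := hS.epi_g
    match n with
    | 0 =>
      rw [ChainComplex.quasiIsoAt₀_iff, ShortComplex.quasiIso_iff_of_zeros']
      · have h : (ShortComplex.mk (Q.augmentation ≫ S.f) S.g (by
            rw [Category.assoc, S.zero, comp_zero])).Exact ∧ Epi S.g := by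
          refine ⟨?_, hg⟩
          let φ : ShortComplex.mk (Q.augmentation ≫ S.f) S.g (by
            rw [Category.assoc, S.zero, comp_zero]) ⟶ S :=
            { τ₁ := Q.augmentation, τ₂ := 𝟙 _, τ₃ := 𝟙 _ }
          have : Epi φ.τ₁ := inferInstanceAs (Epi (Q.augmentation))
          have : IsIso φ.τ₂ := inferInstanceAs (IsIso (𝟙 _))
          have : Mono φ.τ₃ := inferInstanceAs (Mono (𝟙 _))
          exact (ShortComplex.exact_iff_of_epi_of_isIso_of_mono φ).2 hS.exact
        refine (ShortComplex.exact_and_epi_g_iff_of_iso ?_).2 h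
        exact ShortComplex.isoMk (Iso.refl _) (Iso.refl _) (Iso.refl _)
          ((Category.id_comp _).trans (Category.comp_id _).symm)
          ((Category.id_comp S.g).trans (by
            refine Eq.trans ?_ (Category.comp_id _).symm
            exact (ChainComplex.toSingle₀Equiv_symm_apply_f_zero
              (C := Q.complex.augment (Q.augmentation ≫ S.f) _) S.g _).symm))
      all_goals rfl
    | 1 =>
      rw [quasiIsoAt_iff_exactAt' _ _ (ChainComplex.exactAt_succ_single_obj _ _),
        HomologicalComplex.exactAt_iff' _ 2 1 0 (by simp) (by simp)]
      have h := Q.exact_augmentation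
      let φ : ShortComplex.mk (Q.complex.d 1 0) (Q.augmentation) (Q.d_comp_augmentation) ⟶
        ShortComplex.mk (Q.complex.d 1 0) (Q.augmentation ≫ S.f) (by
          rw [← Category.assoc, Q.d_comp_augmentation, zero_comp]) :=
            { τ₁ := 𝟙 _, τ₂ := 𝟙 _, τ₃ := S.f }
      have : Epi φ.τ₁ := inferInstanceAs (Epi (𝟙 _))
      have : IsIso φ.τ₂ := inferInstanceAs (IsIso (𝟙 _))
      have : Mono φ.τ₃ := hf
      exact (ShortComplex.exact_iff_of_epi_of_isIso_of_mono φ).1 h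
    | n + 2 =>
      rw [quasiIsoAt_iff_exactAt' _ _ (ChainComplex.exactAt_succ_single_obj _ _),
        HomologicalComplex.exactAt_iff' _ (n + 3) (n + 2) (n + 1) (by simp) (by simp)]
      exact Q.exact_succ n⟩

variable {D : Type*} [Category* D] [Abelian D]

theorem CategoryTheory.ProjectiveResolution.isZero_leftDerived_obj_succ_iff {X : C}
    (P : ProjectiveResolution X) [HasProjectiveResolutions C] (F : C ⥤ D) [F.Additive] (n : ℕ) :
    IsZero ((F.leftDerived (n + 1)).obj X) ↔
      (ShortComplex.mk (F.map (P.complex.d (n + 2) (n + 1))) (F.map (P.complex.d (n + 1) n))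
        (by rw [← F.map_comp, P.complex.d_comp_d, F.map_zero])).Exact := by
  rw [(P.isoLeftDerivedObj F (n + 1)).isZero_iff]
  erw [← HomologicalComplex.exactAt_iff_isZero_homology]
  rw [HomologicalComplex.exactAt_iff' _ (n + 2) (n + 1) n (by simp) (by simp)]
  rfl

/-- Away from its bottom the spliced resolution of `S.X₃` is that of `S.X₁` shifted by one, so both
sides become the same exactness condition. -/
theorem CategoryTheory.Functor.isZero_leftDerived_obj_iff_of_shortExact [HasProjectiveResolutions C]
    (F : C ⥤ D) [F.Additive] {S : ShortComplex C} (hS : S.ShortExact) [Projective S.X₂] (n : ℕ) :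
    IsZero ((F.leftDerived (n + 2)).obj S.X₃) ↔ IsZero ((F.leftDerived (n + 1)).obj S.X₁) := by
  obtain ⟨Q⟩ : Nonempty (ProjectiveResolution S.X₁) := HasProjectiveResolution.out
  rw [(Q.ofShortExact hS).isZero_leftDerived_obj_succ_iff, Q.isZero_leftDerived_obj_succ_iff]
  rfl

/-- By right exactness `F.obj S.X₁` is the cokernel of the first differential of `F(Q)`. Exactness
of the spliced complex in degree one therefore says that this cokernel embeds in `F.obj S.X₂`. -/
theorem CategoryTheory.Functor.isZero_leftDerived_one_obj_iff_of_shortExact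
    [HasProjectiveResolutions C]
    (F : C ⥤ D) [F.Additive] [PreservesFiniteColimits F] {S : ShortComplex C} (hS : S.ShortExact)
    [Projective S.X₂] :
    IsZero ((F.leftDerived 1).obj S.X₃) ↔ Mono (F.map S.f) := by
  obtain ⟨Q⟩ : Nonempty (ProjectiveResolution S.X₁) := HasProjectiveResolution.out
  rw [(Q.ofShortExact hS).isZero_leftDerived_obj_succ_iff]
  have hex : (ShortComplex.mk (F.map (Q.complex.d 1 0)) (F.map (Q.augmentation)) (by
      rw [← F.map_comp, Q.d_comp_augmentation, F.map_zero])).Exact := by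
    have := Q.exact_augmentation.map_of_epi_of_preservesCokernel F inferInstance inferInstance
    exact this
  have hepi : Epi (F.map (Q.augmentation)) := inferInstance
  have w : F.map (Q.complex.d 1 0) ≫ F.map (Q.augmentation) ≫ F.map S.f = 0 := by
    rw [← F.map_comp_assoc, Q.d_comp_augmentation, F.map_zero, zero_comp]
  trans (ShortComplex.mk (F.map (Q.complex.d 1 0)) (F.map (Q.augmentation) ≫ F.map S.f) w).Exact
  · have e : F.map (Q.augmentation ≫ S.f) = F.map Q.augmentation ≫ F.map S.f := F.map_comp _ _
    simp only [← e]
    rfl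
  constructor
  · intro h
    refine Preadditive.mono_of_cancel_zero _ fun {G} g hg => ?_
    obtain ⟨G₁, π₁, _, y, hy⟩ := surjective_up_to_refinements_of_epi (F.map Q.augmentation) g
    obtain ⟨G₂, π₂, _, z, hz⟩ := h.exact_up_to_refinements y (by
      rw [← Category.assoc, ← hy, Category.assoc, hg, comp_zero])
    dsimp at hz
    rw [← cancel_epi π₁, ← cancel_epi π₂, hy, ← Category.assoc, hz, Category.assoc, ← F.map_comp,
      Q.d_comp_augmentation]
    simp
  · intro h
    let φ : ShortComplex.mk (F.map (Q.complex.d 1 0)) (F.map (Q.augmentation)) (by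
      rw [← F.map_comp, Q.d_comp_augmentation, F.map_zero]) ⟶ ShortComplex.mk _ _ w :=
      { τ₁ := 𝟙 _, τ₂ := 𝟙 _, τ₃ := F.map S.f }
    have : Epi φ.τ₁ := inferInstanceAs (Epi (𝟙 _))
    have : IsIso φ.τ₂ := inferInstanceAs (IsIso (𝟙 _))
    have : Mono φ.τ₃ := h
    exact (ShortComplex.exact_iff_of_epi_of_isIso_of_mono φ).1 hex
end

/-! ### Vanishing of Tor: dimension shifting in the first variable. -/

/-- `Tor_{n+1}^A(M, N) = 0`. -/
def TorSuccVanishes (A : Type u) [CommRing A] (n : ℕ) (M N : Type u) [AddCommGroup M] [Module A M]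
    [AddCommGroup N] [Module A N] : Prop :=
  Limits.IsZero (((Tor' (ModuleCat.{u} A) (n + 1)).obj (ModuleCat.of A M)).obj (ModuleCat.of A N))

namespace TorSuccVanishes

variable {A : Type u} [CommRing A]
variable {K P M N : Type u} [AddCommGroup K] [Module A K] [AddCommGroup P] [Module A P]
  [AddCommGroup M] [Module A M] [AddCommGroup N] [Module A N]

theorem congr_left {n : ℕ} (e : K ≃ₗ[A] M) (h : TorSuccVanishes A n K N) :
    TorSuccVanishes A n M N :=
  h.of_iso (((Tor' (ModuleCat.{u} A) (n + 1)).mapIso e.toModuleIso).app _).symm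

theorem shortExact_mk {f : K →ₗ[A] P} {g : P →ₗ[A] M}
    (hf : Function.Injective f) (hfg : Function.Exact f g) (hg : Function.Surjective g) :
    (ShortComplex.mk (ModuleCat.ofHom f) (ModuleCat.ofHom g) (by
      ext x; exact hfg.apply_apply_eq_zero x)).ShortExact where
  exact := (ShortComplex.ShortExact.moduleCat_exact_iff_function_exact _).2 hfg
  mono_f := (ModuleCat.mono_iff_injective _).2 hf
  epi_g := (ModuleCat.epi_iff_surjective _).2 hg

theorem of_projective [Module.Projective A M] (n : ℕ) :
    TorSuccVanishes A n M N :=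
  have : Projective (ModuleCat.of A M) := (IsProjective.iff_projective M).1 inferInstance
  isZero_Tor'_succ_of_projective _ _ _ n

theorem succ_iff [Module.Projective A P] {f : K →ₗ[A] P} {g : P →ₗ[A] M}
    (hf : Function.Injective f) (hfg : Function.Exact f g) (hg : Function.Surjective g) (n : ℕ) :
    TorSuccVanishes A (n + 1) M N ↔ TorSuccVanishes A n K N := by
  have : Projective (ModuleCat.of A P) := (IsProjective.iff_projective P).1 inferInstance
  exact ((MonoidalCategory.tensoringRight (ModuleCat.{u} A)).obj
    (ModuleCat.of A N)).isZero_leftDerived_obj_iff_of_shortExact (shortExact_mk hf hfg hg) n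

theorem zero_iff [Module.Projective A P] {f : K →ₗ[A] P} {g : P →ₗ[A] M}
    (hf : Function.Injective f) (hfg : Function.Exact f g) (hg : Function.Surjective g) :
    TorSuccVanishes A 0 M N ↔ Function.Injective (f.rTensor N) := by
  have : Projective (ModuleCat.of A P) := (IsProjective.iff_projective P).1 inferInstance
  have : Limits.PreservesFiniteColimits
    ((MonoidalCategory.tensoringRight (ModuleCat.{u} A)).obj (ModuleCat.of A N)) :=
    inferInstanceAs (Limits.PreservesFiniteColimits
      (MonoidalCategory.tensorRight (ModuleCat.of A N)))
  refine (((MonoidalCategory.tensoringRight (ModuleCat.{u} A)).obj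
    (ModuleCat.of A N)).isZero_leftDerived_one_obj_iff_of_shortExact
      (shortExact_mk hf hfg hg)).trans ?_
  rw [ModuleCat.mono_iff_injective]
  rfl

end TorSuccVanishes

/-! ### Balancing Tor and shifting in the second variable. -/

section
variable {A : Type*} [CommRing A] {K P M K' Q N : Type*} [AddCommGroup K] [Module A K]
  [AddCommGroup P] [Module A P] [AddCommGroup M] [Module A M] [AddCommGroup K'] [Module A K']
  [AddCommGroup Q] [Module A Q] [AddCommGroup N] [Module A N]

theorem LinearMap.rTensor_lTensor_comm_apply (f : K →ₗ[A] P) (g : Q →ₗ[A] N) (x : K ⊗[A] Q) :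
    f.rTensor N (g.lTensor K x) = g.lTensor P (f.rTensor Q x) := by
  rw [← LinearMap.comp_apply, ← LinearMap.comp_apply, LinearMap.rTensor_comp_lTensor,
    LinearMap.lTensor_comp_rTensor]

/-- A chase in the grid of tensor products of the two right exact sequences. Its symmetry in the two
sequences yields the balancing of $\operatorname{Tor}_1$. -/
theorem LinearMap.lTensor_injective_of_rTensor_injective {f : K →ₗ[A] P} {g : P →ₗ[A] M}
    {f' : K' →ₗ[A] Q} {g' : Q →ₗ[A] N} (hfg : Function.Exact f g) (hg : Function.Surjective g)
    (hfg' : Function.Exact f' g') (hg' : Function.Surjective g')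
    (hP : Function.Injective (f'.lTensor P)) (h : Function.Injective (f.rTensor N)) :
    Function.Injective (f'.lTensor M) := by
  rw [injective_iff_map_eq_zero]
  intro z hz
  obtain ⟨w, rfl⟩ := LinearMap.rTensor_surjective K' hg z
  rw [← LinearMap.rTensor_lTensor_comm_apply] at hz
  obtain ⟨v, hv⟩ := (rTensor_exact Q hfg hg _).1 hz
  have h0 : g'.lTensor K v = 0 := by
    apply h
    rw [LinearMap.rTensor_lTensor_comm_apply, hv, map_zero]
    exact (lTensor_exact P hfg' hg').apply_apply_eq_zero w
  obtain ⟨t, rfl⟩ := (lTensor_exact K hfg' hg' _).1 h0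
  rw [LinearMap.rTensor_lTensor_comm_apply] at hv
  rw [← hP hv]
  exact (rTensor_exact K' hfg hg).apply_apply_eq_zero t

end

theorem Module.exists_free_cover (A : Type u) [CommRing A] (M : Type u) [AddCommGroup M]
    [Module A M] : ∃ (K P : Type u) (_ : AddCommGroup K) (_ : Module A K) (_ : AddCommGroup P)
      (_ : Module A P) (f : K →ₗ[A] P) (g : P →ₗ[A] M), Module.Free A P ∧
      Function.Injective f ∧ Function.Exact f g ∧ Function.Surjective g :=
  ⟨LinearMap.ker (Finsupp.linearCombination A (id : M → M)), M →₀ A, inferInstance, inferInstance,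
    inferInstance, inferInstance, (LinearMap.ker _).subtype, Finsupp.linearCombination A id,
    inferInstance, Subtype.val_injective, LinearMap.exact_subtype_ker_map _,
    Finsupp.linearCombination_id_surjective A M⟩

namespace TorSuccVanishes

variable {A : Type u} [CommRing A]
variable {K Q L M N : Type u} [AddCommGroup K] [Module A K] [AddCommGroup Q] [Module A Q]
  [AddCommGroup L] [Module A L] [AddCommGroup M] [Module A M] [AddCommGroup N] [Module A N]

section Flat

variable [Module.Flat A Q] {f : K →ₗ[A] Q} {g : Q →ₗ[A] N}

theorem zero_iff_lTensor
    (hf : Function.Injective f) (hfg : Function.Exact f g) (hg : Function.Surjective g) :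
    TorSuccVanishes A 0 M N ↔ Function.Injective (f.lTensor M) := by
  obtain ⟨S, F, _, _, _, _, i, p, _, hi, hp', hp⟩ := Module.exists_free_cover A M
  rw [zero_iff hi hp' hp]
  constructor
  · exact LinearMap.lTensor_injective_of_rTensor_injective hp' hp hfg hg
      (Module.Flat.lTensor_preserves_injective_linearMap f hf)
  · rw [← i.lTensor_inj_iff_rTensor_inj N,
      f.lTensor_inj_iff_rTensor_inj M]
    exact LinearMap.lTensor_injective_of_rTensor_injective hfg hg hp' hp
      (Module.Flat.lTensor_preserves_injective_linearMap _ hi)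

theorem succ_iff_right
    (hf : Function.Injective f) (hfg : Function.Exact f g) (hg : Function.Surjective g) (n : ℕ) :
    TorSuccVanishes A (n + 1) M N ↔ TorSuccVanishes A n M K := by
  induction n generalizing M with
  | zero =>
    obtain ⟨S, F, _, _, _, _, i, p, _, hi, hp', hp⟩ := Module.exists_free_cover A M
    rw [succ_iff hi hp' hp, zero_iff_lTensor hf hfg hg, zero_iff hi hp' hp]
    -- Both conditions say that $S\otimes K\to F\otimes Q$ is injective, factored once through
    -- $S\otimes Q$ and once through $F\otimes K$.
    have h1 := Module.Flat.rTensor_preserves_injective_linearMap (M := Q) _ hi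
    have h2 := Module.Flat.lTensor_preserves_injective_linearMap (M := F) _ hf
    rw [← h1.of_comp_iff, ← h2.of_comp_iff]
    refine iff_of_eq (congrArg _ (funext fun x => ?_))
    exact LinearMap.rTensor_lTensor_comm_apply _ _ _
  | succ n ih =>
    obtain ⟨S, F, _, _, _, _, i, p, _, hi, hp', hp⟩ := Module.exists_free_cover A M
    rw [succ_iff hi hp' hp, ih, ← succ_iff hi hp' hp]

end Flat

theorem of_flat [Module.Flat A N] (n : ℕ) : TorSuccVanishes A n M N := by
  have h : ∀ M : Type u, ∀ [AddCommGroup M] [Module A M], TorSuccVanishes A n M N := by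
    induction n with
    | zero =>
      intro M _ _
      obtain ⟨S, F, _, _, _, _, i, p, _, hi, hp', hp⟩ := Module.exists_free_cover A M
      rw [zero_iff hi hp' hp]
      exact Module.Flat.rTensor_preserves_injective_linearMap _ hi
    | succ n ih =>
      intro M _ _
      obtain ⟨S, F, _, _, _, _, i, p, _, hi, hp', hp⟩ := Module.exists_free_cover A M
      rw [succ_iff hi hp' hp]
      exact ih _
  exact h M

theorem of_hasFlatDimensionLE {d : ℕ} (h : HasFlatDimensionLE A d N) {n : ℕ} (hn : d ≤ n) :
    TorSuccVanishes A n M N := by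
  induction d generalizing N n with
  | zero =>
    have : Module.Flat A N := h
    exact of_flat n
  | succ d ih =>
    obtain ⟨F, _, _, f, hF, hf, hk⟩ := h
    obtain ⟨n, rfl⟩ : ∃ m, n = m + 1 := ⟨n - 1, by omega⟩
    rw [succ_iff_right (f := (LinearMap.ker f).subtype) Subtype.val_injective
      (LinearMap.exact_subtype_ker_map f) hf]
    exact ih hk (by omega)

/-- The hypothesis concerns $\operatorname{Tor}_{n+1}$. Shifting along free covers of `N` reduces to
$\operatorname{Tor}_1(A/I,-)=0$, the ideal criterion for flatness. -/
theorem hasFlatDimensionLE {n : ℕ} (h : ∀ I : Ideal A, TorSuccVanishes A n (A ⧸ I) N) :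
    HasFlatDimensionLE A n N := by
  induction n generalizing N with
  | zero =>
    refine (Module.Flat.iff_rTensor_injective' (R := A) (M := N)).2 fun I => ?_
    refine (zero_iff (f := I.subtype) (g := I.mkQ) Subtype.val_injective ?_
      (Submodule.mkQ_surjective I)).1 (h I)
    exact LinearMap.exact_subtype_mkQ I
  | succ n ih =>
    obtain ⟨S, F, _, _, _, _, i, p, _, hi, hp', hp⟩ := Module.exists_free_cover A N
    refine ⟨F, inferInstance, inferInstance, p, inferInstance, hp, ih fun I => ?_⟩
    exact (succ_iff_right (f := (LinearMap.ker p).subtype) Subtype.val_injective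
      (LinearMap.exact_subtype_ker_map p) hp n).1 (h I)

/-! ### Vanishing of Tor along short exact sequences. -/

section Middle

variable {L₁ L₂ L₃ : Type u} [AddCommGroup L₁] [Module A L₁] [AddCommGroup L₂] [Module A L₂]
  [AddCommGroup L₃] [Module A L₃] {f : L₁ →ₗ[A] L₂} {g : L₂ →ₗ[A] L₃}

theorem middle (hf : Function.Injective f) (hfg : Function.Exact f g) (hg : Function.Surjective g)
    {n : ℕ} (h₁ : TorSuccVanishes A n L₁ N) (h₃ : TorSuccVanishes A n L₃ N) :
    TorSuccVanishes A n L₂ N := by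
  induction n generalizing N with
  | zero =>
    obtain ⟨S, F, _, _, _, _, i, p, _, hi, hp', hp⟩ := Module.exists_free_cover A N
    rw [zero_iff_lTensor hi hp' hp] at h₁ h₃ ⊢
    rw [injective_iff_map_eq_zero]
    intro z hz
    have hz₃ : g.rTensor _ z = 0 := by
      apply h₃
      rw [← LinearMap.rTensor_lTensor_comm_apply, hz, map_zero, map_zero]
    obtain ⟨y, rfl⟩ := (rTensor_exact _ hfg hg _).1 hz₃
    rw [← LinearMap.rTensor_lTensor_comm_apply] at hz
    have := (injective_iff_map_eq_zero _).1
      (Module.Flat.rTensor_preserves_injective_linearMap (M := F) f hf) _ hz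
    rw [(injective_iff_map_eq_zero _).1 h₁ _ this, map_zero]
  | succ n ih =>
    obtain ⟨S, F, _, _, _, _, i, p, _, hi, hp', hp⟩ := Module.exists_free_cover A N
    rw [succ_iff_right hi hp' hp] at h₁ h₃ ⊢
    exact ih h₁ h₃

theorem right (hf : Function.Injective f) (hfg : Function.Exact f g) (hg : Function.Surjective g)
    {n : ℕ} (h₁ : TorSuccVanishes A n L₁ N) (h₂ : TorSuccVanishes A (n + 1) L₂ N) :
    TorSuccVanishes A (n + 1) L₃ N := by
  induction n generalizing N with
  | zero =>
    obtain ⟨S, F, _, _, _, _, i, p, _, hi, hp', hp⟩ := Module.exists_free_cover A N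
    rw [succ_iff_right hi hp' hp] at h₂ ⊢
    rw [zero_iff_lTensor hi hp' hp] at h₁
    obtain ⟨T, G, _, _, _, _, j, q, _, hj, hq', hq⟩ := Module.exists_free_cover A S
    rw [zero_iff_lTensor hj hq' hq] at h₂ ⊢
    -- Composed with $L_2\otimes S\to L_2\otimes F$, this map is $L_1\otimes S\to L_1\otimes F\to
    -- L_2\otimes F$, injective by `h₁` and flatness of `F`.
    have hfK : Function.Injective (f.rTensor S) := by
      refine Function.Injective.of_comp (f := i.lTensor L₂) ?_
      have := (Module.Flat.rTensor_preserves_injective_linearMap (M := F) f hf).comp h₁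
      convert this using 1
      exact funext fun x => (LinearMap.rTensor_lTensor_comm_apply _ _ _).symm
    exact LinearMap.lTensor_injective_of_rTensor_injective hfg hg hq' hq h₂ hfK
  | succ n ih =>
    obtain ⟨S, F, _, _, _, _, i, p, _, hi, hp', hp⟩ := Module.exists_free_cover A N
    rw [succ_iff_right hi hp' hp] at h₁ h₂ ⊢
    exact ih h₁ h₂

end Middle

/-! ### Flat base change. -/

theorem baseChange_iff {A' : Type u} [CommRing A'] [Algebra A A'] [Module.Flat A A'] [Module A' N]
    [IsScalarTower A A' N] (n : ℕ) :
    TorSuccVanishes A' n (A' ⊗[A] M) N ↔ TorSuccVanishes A n M N := by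
  have h : ∀ M : Type u, ∀ [AddCommGroup M] [Module A M],
      TorSuccVanishes A' n (A' ⊗[A] M) N ↔ TorSuccVanishes A n M N := by
    induction n with
    | zero =>
      intro M _ _
      obtain ⟨S, F, _, _, _, _, i, p, _, hi, hp', hp⟩ := Module.exists_free_cover A M
      rw [zero_iff hi hp' hp, zero_iff (f := i.baseChange A')
        (g := p.baseChange A') (Module.Flat.lTensor_preserves_injective_linearMap _ hi)
        (lTensor_exact A' hp' hp) (LinearMap.lTensor_surjective A' hp)]
      rw [← LinearMap.lTensor_inj_iff_rTensor_inj, ← LinearMap.lTensor_inj_iff_rTensor_inj]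
      let e₁ := AlgebraTensorModule.cancelBaseChange A A' A' N S
      let e₂ := AlgebraTensorModule.cancelBaseChange A A' A' N F
      rw [← e₂.injective.of_comp_iff, ← Function.Injective.of_comp_iff' _ e₁.bijective]
      refine iff_of_eq (congrArg _ (funext fun x => ?_))
      simp only [Function.comp_apply]
      induction x using TensorProduct.induction_on with
      | zero => simp
      | add x y hx hy => simp only [map_add, hx, hy]
      | tmul m y =>
        induction y using TensorProduct.induction_on with
        | zero => simp
        | add x y hx hy => simp only [map_add, tmul_add, hx, hy]
        | tmul a s => simp [e₁, e₂]
    | succ n ih =>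
      intro M _ _
      obtain ⟨S, F, _, _, _, _, i, p, _, hi, hp', hp⟩ := Module.exists_free_cover A M
      rw [succ_iff hi hp' hp, succ_iff (f := i.baseChange A')
        (g := p.baseChange A') (Module.Flat.lTensor_preserves_injective_linearMap _ hi)
        (lTensor_exact A' hp' hp) (LinearMap.lTensor_surjective A' hp)]
      exact ih _
  exact h M

end TorSuccVanishes

/-! ### Nakayama over `B`, and passage from the residue field to all cyclic modules. -/

theorem Module.exists_finite_free_cover (A : Type u) [CommRing A] [IsNoetherianRing A]
    (M : Type u) [AddCommGroup M] [Module A M] [Module.Finite A M] :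
    ∃ (K P : Type u) (_ : AddCommGroup K) (_ : Module A K) (_ : AddCommGroup P)
      (_ : Module A P) (f : K →ₗ[A] P) (g : P →ₗ[A] M), Module.Free A P ∧ Module.Finite A P ∧
      Module.Finite A K ∧
      Function.Injective f ∧ Function.Exact f g ∧ Function.Surjective g := by
  obtain ⟨n, p, hp⟩ := Module.Finite.exists_fin' A M
  exact ⟨LinearMap.ker p, Fin n → A, inferInstance, inferInstance, inferInstance, inferInstance,
    (LinearMap.ker p).subtype, p, inferInstance, inferInstance, inferInstance,
    Subtype.val_injective, LinearMap.exact_subtype_ker_map p, hp⟩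

theorem Module.Finite.tensorProduct_of_tower (A B N K : Type*) [CommRing A] [CommRing B]
    [Algebra A B] [AddCommGroup N] [Module A N] [Module B N] [IsScalarTower A B N]
    [AddCommGroup K] [Module A K] [Module.Finite B N] [Module.Finite A K] :
    Module.Finite B (N ⊗[A] K) :=
  Module.Finite.equiv (AlgebraTensorModule.cancelBaseChange A B B N K)

/-- The kernel is a `B`-submodule of the finite `B`-module $N\otimes_A K$, so Nakayama applies over
`B` although `N` need not be finite over `A`. -/
theorem LinearMap.lTensor_injective_of_ker_le_smul {A B N K P : Type*} [CommRing A] [CommRing B]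
    [IsLocalRing B] [IsNoetherianRing B]
    [Algebra A B] [AddCommGroup N] [Module A N] [Module B N] [IsScalarTower A B N]
    [AddCommGroup K] [Module A K] [Module.Finite B N] [Module.Finite A K]
    [AddCommGroup P] [Module A P] (f : K →ₗ[A] P) (x : A)
    (hx : algebraMap A B x ∈ IsLocalRing.maximalIdeal B)
    (h : ∀ z, f.lTensor N z = 0 → ∃ y, f.lTensor N y = 0 ∧ z = x • y) :
    Function.Injective (f.lTensor N) := by
  have := Module.Finite.tensorProduct_of_tower A B N K
  let F : N ⊗[A] K →ₗ[B] N ⊗[A] P := AlgebraTensorModule.lTensor B N f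
  have hF : ∀ z, F z = f.lTensor N z := fun z => rfl
  have hbot : LinearMap.ker F = ⊥ := by
    refine Submodule.eq_bot_of_le_smul_of_le_jacobson_bot (Ideal.span {algebraMap A B x}) _
      (IsNoetherian.noetherian _) ?_ ?_
    · intro z hz
      obtain ⟨y, hy, rfl⟩ := h z hz
      rw [← algebraMap_smul B x y]
      exact Submodule.smul_mem_smul (Ideal.mem_span_singleton_self _) hy
    · rw [IsLocalRing.jacobson_eq_maximalIdeal _ bot_ne_top, Ideal.span_singleton_le_iff_mem]
      exact hx
  have hinj : Function.Injective F := LinearMap.ker_eq_bot.1 hbot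
  exact hinj

/-- Sequences $0\to L\xrightarrow{(x,g)}L\times P\to L_3\to0$ are stable under syzygies: with $K$
the syzygy of $L$, the syzygy of $L_3$ is the cokernel of $(x,-i)\colon K\to K\times P_1$. The extra
factor `P` is there for this stability, since multiplication by `x` alone does not keep its shape.
-/
theorem LinearMap.exists_smul_prod_syzygy {A K P₁ L P L₃ : Type*} [CommRing A]
    [AddCommGroup K] [Module A K] [AddCommGroup P₁] [Module A P₁] [AddCommGroup L] [Module A L]
    [AddCommGroup P] [Module A P] [AddCommGroup L₃] [Module A L₃] {x : A}
    (g : L →ₗ[A] P) (h : L × P →ₗ[A] L₃)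
    (hinj : ∀ l, x • l = 0 → g l = 0 → l = 0)
    (hex : ∀ l p, h (l, p) = 0 ↔ ∃ y, x • y = l ∧ g y = p)
    {i : K →ₗ[A] P₁} {p : P₁ →ₗ[A] L} (hi : Function.Injective i) (hip : Function.Exact i p)
    (hp : Function.Surjective p) :
    ∃ φ : K × P₁ →ₗ[A] LinearMap.ker (h ∘ₗ p.prodMap LinearMap.id),
      (∀ k b, (φ (k, b) : P₁ × P) = (i k + x • b, g (p b))) ∧ Function.Surjective φ ∧
      ∀ k b, φ (k, b) = 0 ↔ ∃ c, x • c = k ∧ (-i) c = b := by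
  let φ₀ : K × P₁ →ₗ[A] P₁ × P :=
    (i.coprod (x • LinearMap.id)).prod (g ∘ₗ p ∘ₗ LinearMap.snd A K P₁)
  have hφ₀ : ∀ k b, φ₀ (k, b) = (i k + x • b, g (p b)) := fun k b => rfl
  have hpi : ∀ k, p (i k) = 0 := hip.apply_apply_eq_zero
  let φ : K × P₁ →ₗ[A] LinearMap.ker (h ∘ₗ p.prodMap LinearMap.id) :=
    φ₀.codRestrict _ fun ⟨k, b⟩ => by
      rw [hφ₀, LinearMap.mem_ker]
      refine (hex _ _).2 ⟨p b, ?_, rfl⟩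
      simp [hpi]
  have hφ : ∀ k b, (φ (k, b) : P₁ × P) = (i k + x • b, g (p b)) := fun k b => rfl
  refine ⟨φ, hφ, ?_, fun k b => ?_⟩
  · rintro ⟨⟨a, c⟩, hac⟩
    obtain ⟨l, hl, hl'⟩ := (hex _ _).1 hac
    obtain ⟨b, rfl⟩ := hp l
    have : p (a - x • b) = 0 := by
      rw [map_sub, map_smul, hl]
      simp
    obtain ⟨k, hk⟩ := (hip _).1 this
    refine ⟨(k, b), Subtype.ext ?_⟩
    rw [hφ, hk]
    ext
    · simp
    · exact hl'
  · rw [← Subtype.coe_inj, hφ]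
    constructor
    · intro h0
      have h1 : i k + x • b = 0 := congrArg Prod.fst h0
      have h2 : g (p b) = 0 := congrArg Prod.snd h0
      have h3 : p b = 0 := by
        refine hinj _ ?_ h2
        have := congrArg p h1
        simpa [hpi] using this
      obtain ⟨c, rfl⟩ := (hip _).1 h3
      refine ⟨-c, hi ?_, by simp⟩
      rw [map_smul, map_neg, smul_neg, eq_comm]
      exact eq_neg_of_add_eq_zero_left h1
    · rintro ⟨c, rfl, rfl⟩
      simp [hpi]

namespace TorSuccVanishes

variable {A : Type u} [CommRing A] [IsNoetherianRing A]
variable {N : Type u} [AddCommGroup N] [Module A N]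

/-- In the long exact sequence, `h₃` makes multiplication by `x` surjective on
$\operatorname{Tor}_{n+1}(L,N)$, which is finite over `B`, hence zero by Nakayama. Syzygies reduce
this to $\operatorname{Tor}_1$, realised as the kernel of $N\otimes K\to N\otimes P_1$. -/
theorem of_exact_smul_prod (B : Type*) [CommRing B] [IsLocalRing B] [IsNoetherianRing B]
    [Algebra A B] [Module B N] [IsScalarTower A B N] [Module.Finite B N] {x : A}
    (hx : algebraMap A B x ∈ IsLocalRing.maximalIdeal B) {n : ℕ}
    {L P L₃ : Type u} [AddCommGroup L] [Module A L] [Module.Finite A L]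
    [AddCommGroup P] [Module A P] [Module.Projective A P] [AddCommGroup L₃] [Module A L₃]
    (g : L →ₗ[A] P) (h : L × P →ₗ[A] L₃)
    (hinj : ∀ l, x • l = 0 → g l = 0 → l = 0)
    (hex : ∀ l p, h (l, p) = 0 ↔ ∃ y, x • y = l ∧ g y = p)
    (hsurj : Function.Surjective h) (h₃ : TorSuccVanishes A n L₃ N) :
    TorSuccVanishes A n L N := by
  induction n generalizing L P L₃ with
  | zero =>
    obtain ⟨K, P₁, _, _, _, _, i, p, _, _, _, hi, hip, hp⟩ := Module.exists_finite_free_cover A L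
    obtain ⟨φ, hφ, hφs, hφk⟩ := LinearMap.exists_smul_prod_syzygy g h hinj hex hi hip hp
    have hsurj' : Function.Surjective (h ∘ₗ p.prodMap LinearMap.id) :=
      hsurj.comp (hp.prodMap Function.surjective_id)
    rw [zero_iff (f := (LinearMap.ker (h ∘ₗ p.prodMap LinearMap.id)).subtype)
      Subtype.val_injective (LinearMap.exact_subtype_ker_map _) hsurj',
      ← LinearMap.lTensor_inj_iff_rTensor_inj] at h₃
    rw [zero_iff hi hip hp, ← LinearMap.lTensor_inj_iff_rTensor_inj]
    refine LinearMap.lTensor_injective_of_ker_le_smul (B := B) i x hx fun z hz => ?_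
    let ψ : K →ₗ[A] K × P₁ := (x • LinearMap.id).prod (-i)
    have hψ : Function.Exact ψ φ := by
      rintro ⟨k, b⟩
      rw [hφk]
      refine exists_congr fun c => ?_
      rw [← Prod.mk_inj]
      rfl
    have h0 : φ.lTensor N ((LinearMap.inl A K P₁).lTensor N z) = 0 := by
      apply h₃
      rw [← LinearMap.comp_apply, ← LinearMap.comp_apply, ← LinearMap.lTensor_comp,
        ← LinearMap.lTensor_comp, map_zero]
      have : (LinearMap.ker (h ∘ₗ p.prodMap LinearMap.id)).subtype ∘ₗ φ ∘ₗ LinearMap.inl A K P₁ =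
          LinearMap.inl A P₁ P ∘ₗ i := by
        refine LinearMap.ext fun k => ?_
        refine (hφ k 0).trans ?_
        simp
      rw [LinearMap.comp_assoc, this, LinearMap.lTensor_comp, LinearMap.comp_apply, hz, map_zero]
    obtain ⟨y, hy⟩ := (lTensor_exact N hψ hφs _).1 h0
    -- The two coordinates of `hy` say that `y` again lies in the kernel and that $xy=z$.
    refine ⟨y, ?_, ?_⟩
    · have := congrArg ((LinearMap.snd A K P₁).lTensor N) hy
      rw [← LinearMap.comp_apply, ← LinearMap.comp_apply, ← LinearMap.lTensor_comp,
        ← LinearMap.lTensor_comp, LinearMap.snd_comp_inl, LinearMap.snd_prod,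
        LinearMap.lTensor_neg, LinearMap.lTensor_zero] at this
      simpa using this
    · have := congrArg ((LinearMap.fst A K P₁).lTensor N) hy
      rw [← LinearMap.comp_apply, ← LinearMap.comp_apply, ← LinearMap.lTensor_comp,
        ← LinearMap.lTensor_comp, LinearMap.fst_comp_inl, LinearMap.fst_prod,
        LinearMap.lTensor_smul, LinearMap.lTensor_id] at this
      simpa using this.symm
  | succ n ih =>
    obtain ⟨K, P₁, _, _, _, _, i, p, _, _, _, hi, hip, hp⟩ := Module.exists_finite_free_cover A L
    obtain ⟨φ, hφ, hφs, hφk⟩ := LinearMap.exists_smul_prod_syzygy g h hinj hex hi hip hp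
    have hsurj' : Function.Surjective (h ∘ₗ p.prodMap LinearMap.id) :=
      hsurj.comp (hp.prodMap Function.surjective_id)
    rw [succ_iff (f := (LinearMap.ker (h ∘ₗ p.prodMap LinearMap.id)).subtype)
      Subtype.val_injective (LinearMap.exact_subtype_ker_map _) hsurj'] at h₃
    rw [succ_iff hi hip hp]
    refine ih (-i) φ (fun l _ hl => hi ?_) hφk hφs h₃
    rw [map_zero]
    exact neg_eq_zero.1 hl

theorem of_exact_smul (B : Type*) [CommRing B] [IsLocalRing B] [IsNoetherianRing B]
    [Algebra A B] [Module B N] [IsScalarTower A B N] [Module.Finite B N] {x : A}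
    (hx : algebraMap A B x ∈ IsLocalRing.maximalIdeal B) {n : ℕ}
    {L L₃ : Type u} [AddCommGroup L] [Module A L] [Module.Finite A L]
    [AddCommGroup L₃] [Module A L₃] (h : L →ₗ[A] L₃) (hinj : ∀ l : L, x • l = 0 → l = 0)
    (hex : ∀ l, h l = 0 ↔ ∃ y, x • y = l) (hsurj : Function.Surjective h)
    (h₃ : TorSuccVanishes A n L₃ N) : TorSuccVanishes A n L N :=
  of_exact_smul_prod B hx (0 : L →ₗ[A] PUnit.{u + 1}) (h ∘ₗ LinearMap.fst A L PUnit.{u + 1})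
    (fun l hl _ => hinj l hl) (fun l p => by simp [hex]) (hsurj.comp Prod.fst_surjective) h₃

/-- Noetherian induction on `I`, with the degree fixed. For a prime $I\ne\mathfrak m$, some
$x\in\mathfrak m\setminus I$ is regular on $A/I$ and $A/(I+(x))$ is already known. If $ab\in I$ with
$a,b\notin I$, then $A/I$ is an extension of $A/(I+(a))$ by $A/(I:a)$. -/
theorem quotient_of_residueField (B : Type*) [CommRing B] [IsLocalRing B] [IsNoetherianRing B]
    [Algebra A B] [Module B N] [IsScalarTower A B N] [Module.Finite B N]
    [IsLocalRing A] [IsLocalHom (algebraMap A B)] {n : ℕ}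
    (h : TorSuccVanishes A n (A ⧸ IsLocalRing.maximalIdeal A) N) (I : Ideal A) :
    TorSuccVanishes A n (A ⧸ I) N := by
  induction I using WellFoundedGT.induction with
  | ind I ih =>
  by_cases hI : I = ⊤
  · subst hI
    have : Subsingleton (A ⧸ (⊤ : Ideal A)) := Ideal.Quotient.subsingleton_iff.2 rfl
    exact of_projective n
  let q (a : A) : (A ⧸ I) →ₗ[A] A ⧸ (I ⊔ Ideal.span {a}) := Submodule.factor le_sup_left
  have hq : ∀ a, Function.Surjective (q a) := fun a => Submodule.factor_surjective _
  have hq' : ∀ a y, q a (Ideal.Quotient.mk I y) = 0 ↔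
      ∃ c, Ideal.Quotient.mk I (a * c) = Ideal.Quotient.mk I y := by
    intro a y
    have : q a (Ideal.Quotient.mk I y) = Ideal.Quotient.mk (I ⊔ Ideal.span {a}) y := rfl
    rw [this, Ideal.Quotient.eq_zero_iff_mem, Submodule.mem_sup]
    simp only [Ideal.Quotient.eq, Ideal.mem_span_singleton']
    constructor
    · rintro ⟨u, hu, _, ⟨c, rfl⟩, rfl⟩
      refine ⟨c, ?_⟩
      convert I.neg_mem hu using 1
      ring
    · rintro ⟨c, hc⟩
      exact ⟨_, I.neg_mem hc, _, ⟨c, rfl⟩, by ring⟩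
  have hlt : ∀ a, a ∉ I → I < I ⊔ Ideal.span {a} := fun a ha =>
    SetLike.lt_iff_le_and_exists.2 ⟨le_sup_left, a,
      Ideal.mem_sup_right (Ideal.mem_span_singleton_self a), ha⟩
  by_cases hprime : I.IsPrime
  · by_cases hm : I = IsLocalRing.maximalIdeal A
    · rwa [hm]
    obtain ⟨x, hx, hxI⟩ := SetLike.exists_of_lt (lt_of_le_of_ne (IsLocalRing.le_maximalIdeal hI) hm)
    have hxB : algebraMap A B x ∈ IsLocalRing.maximalIdeal B := fun hu =>
      hx (isUnit_of_map_unit (algebraMap A B) x hu)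
    refine of_exact_smul B hxB (q x) ?_ ?_ (hq x) (ih _ (hlt x hxI))
    · intro l hl
      obtain ⟨l, rfl⟩ := Ideal.Quotient.mk_surjective l
      have hl' : Ideal.Quotient.mk I (x * l) = 0 := hl
      rw [Ideal.Quotient.eq_zero_iff_mem] at hl' ⊢
      exact (hprime.mem_or_mem hl').resolve_left hxI
    · intro l
      obtain ⟨l, rfl⟩ := Ideal.Quotient.mk_surjective l
      rw [hq']
      constructor
      · rintro ⟨c, hc⟩
        exact ⟨Ideal.Quotient.mk I c, hc⟩
      · rintro ⟨c, hc⟩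
        obtain ⟨c, rfl⟩ := Ideal.Quotient.mk_surjective c
        exact ⟨c, hc⟩
  · obtain ⟨a, ha, b, hb, hab⟩ := (Ideal.not_isPrime_iff.1 hprime).resolve_left hI
    let J : Ideal A := Submodule.comap (LinearMap.mulLeft A a) I
    have hJ : I < J := SetLike.lt_iff_le_and_exists.2
      ⟨fun y hy => I.mul_mem_left a hy, b, hab, hb⟩
    let f : (A ⧸ J) →ₗ[A] A ⧸ I := Submodule.mapQ J I (LinearMap.mulLeft A a) le_rfl
    have hf : ∀ y, f (Ideal.Quotient.mk J y) = Ideal.Quotient.mk I (a * y) := fun y => rfl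
    refine middle (f := f) (g := q a) ?_ ?_ (hq a) (ih J hJ) (ih _ (hlt a ha))
    · rw [injective_iff_map_eq_zero]
      intro y hy
      obtain ⟨y, rfl⟩ := Ideal.Quotient.mk_surjective y
      rw [hf, Ideal.Quotient.eq_zero_iff_mem] at hy
      exact Ideal.Quotient.eq_zero_iff_mem.2 hy
    · intro y
      obtain ⟨y, rfl⟩ := Ideal.Quotient.mk_surjective y
      rw [hq']
      constructor
      · rintro ⟨c, hc⟩
        exact ⟨Ideal.Quotient.mk J c, hc⟩
      · rintro ⟨c, hc⟩
        obtain ⟨c, rfl⟩ := Ideal.Quotient.mk_surjective c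
        exact ⟨c, hc⟩

end TorSuccVanishes

/-! ### Regular local rings: cutting by a parameter, and integrality. -/

section
open IsLocalRing

/-- The class of `x` in the cotangent space extends to a basis, which lifts to generators by
Nakayama. -/
theorem IsLocalRing.exists_span_insert_eq_maximalIdeal {R : Type*} [CommRing R] [IsLocalRing R]
    [IsNoetherianRing R] {x : R} (hx : x ∈ maximalIdeal R) (hx2 : x ∉ maximalIdeal R ^ 2) :
    ∃ T : Set R, T.Finite ∧ T.ncard + 1 ≤ (maximalIdeal R).spanFinrank ∧
      Ideal.span (insert x T) = maximalIdeal R := by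
  let v : CotangentSpace R := (maximalIdeal R).toCotangent ⟨x, hx⟩
  have hv : v ≠ 0 := by rwa [Ne, Ideal.toCotangent_eq_zero]
  have hli : LinearIndepOn (ResidueField R) id {v} := LinearIndepOn.singleton hv
  let b := Module.Basis.extend hli
  let S : Set (CotangentSpace R) := hli.extend (Set.subset_univ _)
  have hvS : v ∈ S := hli.subset_extend _ rfl
  have hspan : Submodule.span (ResidueField R) S = ⊤ := by
    have := b.span_eq
    rwa [Module.Basis.range_extend] at this
  have hfin : S.Finite := Module.Finite.finite_basis b
  have hcard : S.ncard = (maximalIdeal R).spanFinrank := by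
    rw [spanFinrank_maximalIdeal_eq_finrank_cotangentSpace, Module.finrank_eq_nat_card_basis b]
    rfl
  obtain ⟨s, hs⟩ := (maximalIdeal R).toCotangent_surjective.hasRightInverse
  have hspan' : Submodule.span R (insert ⟨x, hx⟩ (s '' (S \ {v}))) = ⊤ := by
    rw [← CotangentSpace.span_image_eq_top_iff, Set.image_insert_eq, ← Set.image_comp,
      hs.comp_eq_id, Set.image_id, Set.insert_sdiff_singleton, Set.insert_eq_of_mem hvS, hspan]
  refine ⟨Subtype.val '' (s '' (S \ {v})), (hfin.sdiff.image _).image _, ?_, ?_⟩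
  · rw [← hcard, ← Set.ncard_sdiff_singleton_add_one hvS hfin]
    gcongr
    exact (Set.ncard_image_le (hfin.sdiff.image _)).trans (Set.ncard_image_le hfin.sdiff)
  · have := congrArg (Submodule.map (maximalIdeal R).subtype) hspan'
    rw [Submodule.map_span, Submodule.map_top, Submodule.range_subtype, Set.image_insert_eq] at this
    exact this

theorem IsLocalRing.spanFinrank_maximalIdeal_quotient_lt {R : Type*} [CommRing R] [IsLocalRing R]
    [IsNoetherianRing R] {x : R} (hx : x ∈ maximalIdeal R) (hx2 : x ∉ maximalIdeal R ^ 2)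
    [IsLocalRing (R ⧸ Ideal.span {x})] :
    (maximalIdeal (R ⧸ Ideal.span {x})).spanFinrank + 1 ≤ (maximalIdeal R).spanFinrank := by
  obtain ⟨T, hT, hcard, hspan⟩ := exists_span_insert_eq_maximalIdeal hx hx2
  have hmap : maximalIdeal (R ⧸ Ideal.span {x}) =
      Ideal.span (Ideal.Quotient.mk (Ideal.span {x}) '' T) := by
    rw [← map_maximalIdeal_of_surjective (Ideal.Quotient.mk (Ideal.span {x}))
      Ideal.Quotient.mk_surjective, ← hspan, Ideal.map_span, Set.image_insert_eq,
      Ideal.Quotient.eq_zero_iff_mem.2 (Ideal.mem_span_singleton_self x), Ideal.span_insert_zero]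
  refine le_trans (Nat.add_le_add_right ?_ 1) hcard
  rw [hmap]
  exact (Submodule.spanFinrank_span_le_ncard_of_finite (hT.image _)).trans (Set.ncard_image_le hT)

/-- Dividing by `x` lowers the embedding dimension by at least one and the Krull dimension by at
most one. -/
theorem IsRegularLocalRing.quotient_span_singleton {R : Type*} [CommRing R] [IsRegularLocalRing R]
    {x : R} (hx : x ∈ maximalIdeal R) (hx2 : x ∉ maximalIdeal R ^ 2) :
    IsRegularLocalRing (R ⧸ Ideal.span {x}) ∧ ∀ [IsLocalRing (R ⧸ Ideal.span {x})],
      (maximalIdeal (R ⧸ Ideal.span {x})).spanFinrank < (maximalIdeal R).spanFinrank := by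
  have : Nontrivial (R ⧸ Ideal.span {x}) := Ideal.Quotient.nontrivial_iff.2 fun h =>
    hx (Ideal.span_singleton_eq_top.1 h)
  have : IsLocalRing (R ⧸ Ideal.span {x}) :=
    IsLocalRing.of_surjective' _ Ideal.Quotient.mk_surjective
  have hlt := IsLocalRing.spanFinrank_maximalIdeal_quotient_lt hx hx2
  refine ⟨.of_spanFinrank_maximalIdeal_le _ ?_, hlt⟩
  have h1 := Ideal.height_le_ringKrullDim_quotient_add_one hx
  rw [maximalIdeal_height_eq_ringKrullDim, ← IsRegularLocalRing.spanFinrank_maximalIdeal] at h1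
  have h2 := (show (((maximalIdeal (R ⧸ Ideal.span {x})).spanFinrank + 1 : ℕ) : WithBot ℕ∞) ≤
    (maximalIdeal R).spanFinrank by exact_mod_cast hlt).trans h1
  push_cast at h2
  exact (ENat.WithBot.add_le_add_one_right_iff).1 h2

theorem IsRegularLocalRing.exists_mem_notMem_sq {R : Type*} [CommRing R] [IsRegularLocalRing R]
    (h : maximalIdeal R ≠ ⊥) : ∃ x ∈ maximalIdeal R, x ∉ maximalIdeal R ^ 2 ∧
      ∀ p ∈ minimalPrimes R, x ∉ p := by
  by_contra! hcon
  have hS : (insert (maximalIdeal R ^ 2) (minimalPrimes R)).Finite :=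
    (minimalPrimes.finite_of_isNoetherianRing R).insert _
  -- Prime avoidance allows two ideals that are not prime; $\mathfrak m^2$ fills both places.
  obtain ⟨J, hJ, hle⟩ := (Ideal.subset_union_prime_finite hS (f := id) (I := maximalIdeal R)
    (maximalIdeal R ^ 2) (maximalIdeal R ^ 2) (fun J hJ hne _ =>
      ((Set.mem_insert_iff.1 hJ).resolve_left hne).1.1)).1 (fun x hx => by
        by_cases hx2 : x ∈ maximalIdeal R ^ 2
        · exact Set.mem_biUnion (Set.mem_insert _ _) hx2
        · obtain ⟨p, hp, hxp⟩ := hcon x hx hx2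
          exact Set.mem_biUnion (Set.mem_insert_of_mem _ hp) hxp)
  rcases Set.mem_insert_iff.1 hJ with rfl | hJ
  · refine h (Submodule.eq_bot_of_le_smul_of_le_jacobson_bot (maximalIdeal R) _
      (IsNoetherian.noetherian _) ?_ (jacobson_eq_maximalIdeal _ bot_ne_top).ge)
    rw [smul_eq_mul, ← sq]
    exact hle
  · have hJm : J = maximalIdeal R := le_antisymm (le_maximalIdeal hJ.1.1.ne_top) hle
    rw [hJm] at hJ
    have h0 : (maximalIdeal R).height = 0 := Ideal.height_eq_zero_iff.2 hJ
    have h1 := IsRegularLocalRing.spanFinrank_maximalIdeal (R := R)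
    rw [← maximalIdeal_height_eq_ringKrullDim, h0] at h1
    exact h ((Submodule.spanFinrank_eq_zero_iff_eq_bot (IsNoetherian.noetherian _)).1
      (by exact_mod_cast h1))

/-- By induction $(x)$ is prime, so it contains a minimal prime $p$. As $x\notin p$, this forces
$p=xp$, and Nakayama gives $p=0$. -/
theorem IsRegularLocalRing.isDomain (R : Type*) [CommRing R] [IsRegularLocalRing R] :
    IsDomain R := by
  obtain ⟨d, hd⟩ : ∃ d, (maximalIdeal R).spanFinrank = d := ⟨_, rfl⟩
  induction d using Nat.strong_induction_on generalizing R with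
  | _ d ih =>
  by_cases hm : maximalIdeal R = ⊥
  · exact (isField_iff_maximalIdeal_eq.2 hm).isDomain
  obtain ⟨x, hx, hx2, hxp⟩ := exists_mem_notMem_sq hm
  obtain ⟨hreg, hlt⟩ := quotient_span_singleton hx hx2
  have hdom : IsDomain (R ⧸ Ideal.span {x}) := ih _ (hd ▸ hlt) _ rfl
  have hprime : (Ideal.span {x}).IsPrime := (Ideal.Quotient.isDomain_iff_prime _).1 hdom
  obtain ⟨p, hp, hpx⟩ := Ideal.exists_minimalPrimes_le (bot_le : ⊥ ≤ Ideal.span {x})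
  have : p.IsPrime := hp.1.1
  have hbot : p = ⊥ := by
    refine Submodule.eq_bot_of_le_smul_of_le_jacobson_bot (Ideal.span {x}) _
      (IsNoetherian.noetherian _) ?_ ?_
    · intro y hy
      obtain ⟨z, rfl⟩ := Ideal.mem_span_singleton.1 (hpx hy)
      exact Submodule.smul_mem_smul (Ideal.mem_span_singleton_self x)
        ((this.mem_or_mem hy).resolve_left (hxp p hp))
    · rw [IsLocalRing.jacobson_eq_maximalIdeal _ bot_ne_top, Ideal.span_singleton_le_iff_mem]
      exact hx
  subst hbot
  exact IsDomain.of_bot_isPrime R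
end

/-! ### From the closed fibre to the residue field, and the conclusion. -/

theorem TorSuccVanishes.quotient_maximalIdeal_of_isRegularLocalRing {A N R : Type u} [CommRing A]
    [IsLocalRing A] [AddCommGroup N] [Module A N] [CommRing R] [Algebra A R] [IsRegularLocalRing R]
    (hR : Function.Surjective (algebraMap A R)) {n : ℕ}
    (h : ∀ m, n ≤ m → TorSuccVanishes A m R N) :
    ∃ k, TorSuccVanishes A k (A ⧸ IsLocalRing.maximalIdeal A) N := by
  obtain ⟨d, hd⟩ : ∃ d, (IsLocalRing.maximalIdeal R).spanFinrank = d := ⟨_, rfl⟩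
  induction d using Nat.strong_induction_on generalizing R n with
  | _ d ih =>
  have := IsRegularLocalRing.isDomain R
  by_cases hm : IsLocalRing.maximalIdeal R = ⊥
  · have hfield : IsField R := IsLocalRing.isField_iff_maximalIdeal_eq.2 hm
    have hker : RingHom.ker (algebraMap A R) = IsLocalRing.maximalIdeal A := by
      let := hfield.toField
      exact IsLocalRing.eq_maximalIdeal (RingHom.ker_isMaximal_of_surjective (algebraMap A R) hR)
    rw [← hker]
    exact ⟨n, (h n le_rfl).congr_left
      (LinearMap.quotKerEquivOfSurjective (Algebra.linearMap A R) hR).symm⟩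
  obtain ⟨x, hx, hx2, -⟩ := IsRegularLocalRing.exists_mem_notMem_sq hm
  obtain ⟨hreg, hlt⟩ := IsRegularLocalRing.quotient_span_singleton hx hx2
  have hx0 : x ≠ 0 := fun h0 => hx2 (h0 ▸ Ideal.zero_mem _)
  refine ih _ (hd ▸ hlt) (R := R ⧸ Ideal.span {x}) (Ideal.Quotient.mk_surjective.comp hR)
    -- Each parameter costs one degree: vanishing for $R/x$ in a degree uses `R` in that degree and
    -- the one below.
    (n := n + 1) (fun m hm => ?_) rfl
  obtain ⟨m, rfl⟩ : ∃ k, m = k + 1 := ⟨m - 1, by omega⟩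
  refine right (f := LinearMap.mulLeft A x)
    (g := (Ideal.Quotient.mkₐ A (Ideal.span {x})).toLinearMap)
    (mul_right_injective₀ hx0) ?_ Ideal.Quotient.mk_surjective (h m (by omega)) (h _ (by omega))
  intro y
  refine Ideal.Quotient.eq_zero_iff_mem.trans (Ideal.mem_span_singleton.trans ?_)
  exact exists_congr fun c => eq_comm

theorem torEventuallyZero_iff {A M N : Type u} [CommRing A] [AddCommGroup M] [Module A M]
    [AddCommGroup N] [Module A N] :
    TorEventuallyZero A M N ↔ ∃ n, ∀ m, n ≤ m → TorSuccVanishes A m M N := by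
  constructor
  · rintro ⟨n, hn⟩
    exact ⟨n, fun m hm => hn (m + 1) (by omega)⟩
  · rintro ⟨n, hn⟩
    refine ⟨n + 1, fun i hi => ?_⟩
    obtain ⟨m, rfl⟩ : ∃ k, i = k + 1 := ⟨i - 1, by omega⟩
    exact hn m (by omega)

/-- Finite flat dimension ascends along weakly regular homomorphisms. -/
theorem IsWeaklyRegular.hasFiniteFlatDimension {A A' : Type u} [CommRing A] [IsLocalRing A]
    [IsNoetherianRing A] [CommRing A'] [IsLocalRing A'] [IsNoetherianRing A'] [Algebra A A']
    (h : IsWeaklyRegular A A') (B : Type u) [CommRing B] [IsLocalRing B] [IsNoetherianRing B]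
    [Algebra A' B] [IsLocalHom (algebraMap A' B)] {N : Type u} [AddCommGroup N] [Module B N]
    [Module A' N] [IsScalarTower A' B N] [Module.Finite B N] [Module A N] [IsScalarTower A A' N]
    (hN : HasFiniteFlatDimension A N) : HasFiniteFlatDimension A' N := by
  have := h.flat
  have := h.regular
  obtain ⟨n, hn⟩ := hN
  have hsurj : Function.Surjective
      (algebraMap A' (A' ⊗[A] IsLocalRing.ResidueField A)) :=
    Algebra.TensorProduct.includeLeft_surjective A' A' IsLocalRing.residue_surjective
  obtain ⟨k, hk⟩ := TorSuccVanishes.quotient_maximalIdeal_of_isRegularLocalRing (N := N) hsurj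
    (n := n) fun m hm =>
      (TorSuccVanishes.baseChange_iff m).2 (TorSuccVanishes.of_hasFlatDimensionLE hn hm)
  -- Vanishing of $\operatorname{Tor}_{k+1}$ against the residue field alone bounds the flat
  -- dimension by `k`.
  exact ⟨k, TorSuccVanishes.hasFlatDimensionLE (hk.quotient_of_residueField B)⟩

theorem lemma2p5 (A A' : Type u) [CommRing A] [IsLocalRing A] [IsNoetherianRing A]
    [CommRing A'] [IsLocalRing A'] [IsNoetherianRing A'] [Algebra A A']
    (h : IsWeaklyRegular A A') (M : Type u) [AddCommGroup M] [Module A M]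
    (hM : IsTestModule A M) :
    IsTestModule A' (A' ⊗[A] M) := by
  have := hM.finite
  have := h.isLocalHom
  have := h.flat
  refine ⟨inferInstance, fun B _ _ _ _ _ N _ _ _ _ _ hTor => ?_⟩
  let : Algebra A B := ((algebraMap A' B).comp (algebraMap A A')).toAlgebra
  let : Module A N := Module.compHom N (algebraMap A A')
  have : IsScalarTower A A' N := IsScalarTower.of_algebraMap_smul fun a n => rfl
  have : IsScalarTower A A' B := IsScalarTower.of_algebraMap_eq fun a => rfl
  have : IsScalarTower A B N := IsScalarTower.of_algebraMap_smul fun a n => by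
    rw [IsScalarTower.algebraMap_apply A A' B, algebraMap_smul, algebraMap_smul]
  have : IsLocalHom (algebraMap A B) :=
    inferInstanceAs (IsLocalHom ((algebraMap A' B).comp (algebraMap A A')))
  refine h.hasFiniteFlatDimension B (hM.test B N ?_)
  rw [torEventuallyZero_iff] at hTor ⊢
  exact hTor.imp fun n hn m hm => (TorSuccVanishes.baseChange_iff m).1 (hn m hm)
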